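/- For $n\ge 1$ let $G_n$ be the smallest integer such that every finite family of pairwise intersecting closed balls (of positive radius) in $\mathbb E^n$ can be pierced by at most $G_n$ points, i.e. there is a set $P$ of at most $G_n$ points meeting every ball of the family. A direction $u\in\mathbb S^{n-1}$ illuminates a boundary point $x$ of a compact set $K\subset\mathbb E^n$ if the half line from $x$ in the direction $u$ intersects the interior of $K$ at points arbitrarily close to $x$; the illumination number $I(K)$ is the smallest number of directions such that every boundary point of $K$ is illuminated by at least one of them. Let $\mathbb B^n$ be the closed unit ball. A spiky ball is a set $\mathrm{Sp}[x_1,\dots,x_m]=\bigcup_{i=1}^m \mathrm{conv}(\mathbb B^n\cup\{x_i\})$ with $m\ge 1$ and $x_1,\dots,x_m\in\mathbb E^n\setminus\mathbb B^n$, where no $x_i$ can be omitted without changing the set; the $x_i$ are then its vertices. It is $2$-illuminable if any two of its vertices can be illuminated by a single direction. Let $$I_{s,n}:=\max\{I(K): K \text{ is a 2-illuminable spiky ball in }\mathbb E^n\}.$$ (The values $G_n$, $I(K)$ and $I_{s,n}$ are understood in $\mathbb N\cup\{\infty\}$, as infimum resp. supremum, so that no finiteness is presupposed.) Corollary. As $n\to\infty$,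 $$G_n\ge\left(\tfrac{2}{\sqrt3}-o(1)\right)^n\qquad\text{and}\qquad I_{s,n}\ge\left(\tfrac{2}{\sqrt3}-o(1)\right)^n .$$ -/

import Mathlib

open Filter Topology Metric
open scoped ENNReal

noncomputable section

/-- A finite family of pairwise intersecting closed balls (of positive radius) in `𝔼ⁿ`. -/
def IsGallaiFamily {n : ℕ} (F : Set (Set (EuclideanSpace ℝ (Fin n)))) : Prop :=
  F.Finite ∧
    (∀ A ∈ F, ∃ (c : EuclideanSpace ℝ (Fin n)) (r : ℝ), 0 < r ∧ A = closedBall c r) ∧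
    ∀ A ∈ F, ∀ B ∈ F, (A ∩ B).Nonempty

/-- The finite point set `P` pierces the family `F`: it meets every member of `F`. -/
def Pierces {n : ℕ} (P : Finset (EuclideanSpace ℝ (Fin n)))
    (F : Set (Set (EuclideanSpace ℝ (Fin n)))) : Prop :=
  ∀ A ∈ F, ∃ p ∈ P, p ∈ A

/-- The Gallai number `G_n`: the smallest integer `k` such that every finite family of pairwise
intersecting closed balls in `𝔼ⁿ` has a piercing set of at most `k` points
(it would be `⊤` if there were no such integer). -/
def gallaiNumber (n : ℕ) : ℕ∞ :=
  ⨅ (k : ℕ) (_ : ∀ F : Set (Set (EuclideanSpace ℝ (Fin n))), IsGallaiFamily F →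
    ∃ P : Finset (EuclideanSpace ℝ (Fin n)), P.card ≤ k ∧ Pierces P F), (k : ℕ∞)

/-- The direction `u` illuminates the boundary point `x` of `K`: the half line from `x` in the
direction `u` meets the interior of `K` at points arbitrarily close to `x`. It is only used for
unit vectors `u` and points `x` of the boundary of `K`. -/
def Illuminates {n : ℕ} (K : Set (EuclideanSpace ℝ (Fin n)))
    (u x : EuclideanSpace ℝ (Fin n)) : Prop :=
  ∀ ε : ℝ, 0 < ε → ∃ t : ℝ, 0 < t ∧ t < ε ∧ x + t • u ∈ interior K

/-- `U` is a finite set of directions (unit vectors) illuminating all boundary points of `K`. -/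
def IsIlluminatingSet {n : ℕ} (K : Set (EuclideanSpace ℝ (Fin n)))
    (U : Finset (EuclideanSpace ℝ (Fin n))) : Prop :=
  (∀ u ∈ U, ‖u‖ = 1) ∧ ∀ x ∈ frontier K, ∃ u ∈ U, Illuminates K u x

/-- The illumination number `I(K)`: the smallest number of directions needed to illuminate all
boundary points of `K` (`⊤` if finitely many directions do not suffice). -/
def illuminationNumber {n : ℕ} (K : Set (EuclideanSpace ℝ (Fin n))) : ℕ∞ :=
  ⨅ (U : Finset (EuclideanSpace ℝ (Fin n))) (_ : IsIlluminatingSet K U), (U.card : ℕ∞)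

/-- `Sp[X]`, the union of the convex hulls `conv (𝔹ⁿ ∪ {x})` over `x ∈ X`. -/
def spikyBall {n : ℕ} (X : Set (EuclideanSpace ℝ (Fin n))) : Set (EuclideanSpace ℝ (Fin n)) :=
  ⋃ x ∈ X, convexHull ℝ (closedBall (0 : EuclideanSpace ℝ (Fin n)) 1 ∪ {x})

/-- `K` is a spiky ball with vertex set `X`: `X` is a finite nonempty set of points outside the
unit ball, `K = Sp[X]`, and no point of `X` can be omitted. -/
def IsSpikyBallWithVertices {n : ℕ} (K X : Set (EuclideanSpace ℝ (Fin n))) : Prop :=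
  X.Finite ∧ X.Nonempty ∧ (∀ x ∈ X, 1 < ‖x‖) ∧ K = spikyBall X ∧
    ∀ x ∈ X, spikyBall (X \ {x}) ≠ spikyBall X

/-- `K` is a 2-illuminable spiky ball: any two of its vertices are illuminated by a common
direction. -/
def IsTwoIlluminableSpikyBall {n : ℕ} (K : Set (EuclideanSpace ℝ (Fin n))) : Prop :=
  ∃ X : Set (EuclideanSpace ℝ (Fin n)), IsSpikyBallWithVertices K X ∧
    ∀ x ∈ X, ∀ y ∈ X, x ≠ y →
      ∃ u : EuclideanSpace ℝ (Fin n), ‖u‖ = 1 ∧ Illuminates K u x ∧ Illuminates K u y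

/-- `I_{s,n}`: the largest illumination number of a 2-illuminable spiky ball in `𝔼ⁿ`. -/
def maxSpikyIllumination (n : ℕ) : ℕ∞ :=
  ⨆ (K : Set (EuclideanSpace ℝ (Fin n))) (_ : IsTwoIlluminableSpikyBall K), illuminationNumber K

end

/-! Both bounds come from one spherical code: for each `b < 2/√3` and large `n`, about `b ^ n` unit
vectors at mutual angles below 120°, with at most `k` of them (`k` independent of `n`) in any cap of
radius 60°. Balls of radius `√3/2` around the code points meet pairwise, while a point piercing one
of them lies in the 60° cone about its centre, so it pierces at most `k`. The spiky ball with
vertices `(2/√3) y i` has spikes of half-angle 60°: two vertices are lit along the negative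
bisector, yet one direction lights at most `k`. Hence both numbers are at least `b ^ n / k`, and
letting `b` tend to `2/√3` absorbs `k`.

The code (`exists_spherical_code`) is chosen greedily in the unit ball. A cap of radius 60° has
relative measure at most `(√3/2) ^ n`, so fewer than `(2/√3) ^ n` points forbid only a small set.
Occupancy is controlled over an exponential net of slightly wider caps by an exponential moment. -/

/-! ### Greedy random selection -/

open MeasureTheory in
/-- Greedy selection by the first moment method: points outside the null set `Z`, no later point
bad for an earlier one, and with a controlled exponential moment of the numbers of points in the
sets `S t`. -/
theorem exists_greedy_selection {α ι : Type*} [MeasurableSpace α] (μ : Measure α)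
    [IsProbabilityMeasure μ] (T : Finset ι) (S : ι → Set α) (Bad : α → Set α) (Z : Set α)
    [∀ t, DecidablePred (· ∈ S t)]
    (hS : ∀ t, MeasurableSet (S t)) (hB : ∀ x, MeasurableSet (Bad x)) (hZm : MeasurableSet Z)
    (hZ : μ.real Z = 0) {q A : ℝ} (hA : 0 ≤ A) (hSq : ∀ t ∈ T, μ.real (S t) ≤ q)
    (hBq : ∀ x, x ∉ Z → μ.real (Bad x) ≤ q) (m : ℕ) (hm : m * q ≤ 1 / 2) (hq : 0 ≤ q) :
    ∃ x : ℕ → α, (∀ i < m, x i ∉ Z) ∧ (∀ i j, i < j → j < m → x j ∉ Bad (x i)) ∧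
      ∑ t ∈ T, (1 + A) ^ ((Finset.range m).filter (fun i => x i ∈ S t)).card
        ≤ T.card * (1 + 2 * A * q) ^ m := by
  induction m with
  | zero =>
    obtain ⟨x⟩ := μ.nonempty_of_neZero
    exact ⟨fun _ => x, by simp, by simp, by simp⟩
  | succ m ih =>
    push_cast at hm
    obtain ⟨x, hxZ, hxB, hxS⟩ := ih (by nlinarith)
    set W : Set α := Z ∪ ⋃ i ∈ Finset.range m, Bad (x i) with hW
    have hWm : MeasurableSet W :=
      hZm.union (Finset.measurableSet_biUnion _ fun i _ => hB _)
    have hWq : μ.real W ≤ 1 / 2 := by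
      calc μ.real W ≤ μ.real Z + μ.real (⋃ i ∈ Finset.range m, Bad (x i)) :=
            measureReal_union_le _ _
        _ ≤ 0 + ∑ i ∈ Finset.range m, μ.real (Bad (x i)) :=
            add_le_add hZ.le (measureReal_biUnion_finset_le _ _)
        _ ≤ 0 + ∑ i ∈ Finset.range m, q := by
            gcongr with i hi
            exact hBq _ (hxZ i (Finset.mem_range.1 hi))
        _ ≤ 1 / 2 := by simp; nlinarith
    have hG : 1 / 2 ≤ μ.real Wᶜ := by
      rw [probReal_compl_eq_one_sub hWm]; linarith
    have hG0 : μ Wᶜ ≠ 0 := by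
      intro h; rw [measureReal_def, h] at hG; norm_num at hG
    set w : ι → ℝ := fun t =>
      (1 + A) ^ ((Finset.range m).filter (fun i => x i ∈ S t)).card with hw
    have hw0 : ∀ t, 0 ≤ w t := fun t => by positivity
    set f : α → ℝ := fun y => ∑ t ∈ T, w t * (1 + A * (S t).indicator 1 y) with hf
    have hfi : ∀ t, Integrable (fun y => w t * (1 + A * (S t).indicator (1 : α → ℝ) y))
        (μ.restrict Wᶜ) := fun t =>
      (((integrable_const (1 : ℝ)).add
        (((integrable_const (1 : ℝ)).indicator (hS t)).const_mul A))).const_mul _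
    -- Some allowed point does no worse than the average over the allowed set. That set has measure
    -- at least 1/2, so conditioning at most doubles `q`; this is the 2 in `1 + 2 * A * q`.
    obtain ⟨y, hyG, hy⟩ := exists_le_setAverage hG0 (measure_ne_top μ _)
      (f := f) (integrable_finsetSum _ fun t _ => hfi t)
    have hint : ∫ a in Wᶜ, f a ∂μ ≤ ∑ t ∈ T, w t * (μ.real Wᶜ + A * q) := by
      rw [hf, integral_finsetSum _ fun t _ => hfi t]
      refine Finset.sum_le_sum fun t ht => ?_
      rw [integral_const_mul]
      refine mul_le_mul_of_nonneg_left ?_ (hw0 t)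
      have hi : Integrable ((S t).indicator (1 : α → ℝ)) (μ.restrict Wᶜ) :=
        (integrable_const (1 : ℝ)).indicator (hS t)
      rw [integral_add (integrable_const _) (hi.const_mul A), integral_const_mul,
        integral_indicator_one (hS t)]
      have h1 : (μ.restrict Wᶜ).real (S t) ≤ q := by
        rw [measureReal_restrict_apply (hS t)]
        exact (measureReal_mono Set.inter_subset_left).trans (hSq t ht)
      simp only [integral_const, smul_eq_mul, mul_one, measureReal_restrict_apply_univ]
      gcongr
    have hfy : f y ≤ (∑ t ∈ T, w t) * (1 + 2 * A * q) := by
      have hGpos : 0 < μ.real Wᶜ := by linarith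
      have hs0 : 0 ≤ ∑ t ∈ T, w t := Finset.sum_nonneg fun t _ => hw0 t
      rw [setAverage_eq, smul_eq_mul] at hy
      refine hy.trans ?_
      rw [inv_mul_le_iff₀ hGpos]
      refine hint.trans ?_
      rw [← Finset.sum_mul, mul_left_comm]
      refine mul_le_mul_of_nonneg_left ?_ hs0
      nlinarith [mul_nonneg hA hq]
    have hyW : y ∉ Z ∧ ∀ i < m, y ∉ Bad (x i) := by
      simpa [hW] using hyG
    refine ⟨Function.update x m y, ?_, ?_, ?_⟩
    · intro i hi
      rcases eq_or_ne i m with rfl | h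
      · simpa using hyW.1
      · rw [Function.update_of_ne h]; exact hxZ i (by omega)
    · intro i j hij hj
      rw [Function.update_of_ne (show i ≠ m by omega)]
      rcases eq_or_ne j m with rfl | h
      · simpa using hyW.2 i hij
      · rw [Function.update_of_ne h]; exact hxB i j hij (by omega)
    · have key : ∀ t, (1 + A) ^ ((Finset.range (m + 1)).filter
          (fun i => Function.update x m y i ∈ S t)).card
          = w t * (1 + A * (S t).indicator 1 y) := by
        intro t
        have h1 : (Finset.range m).filter (fun i => Function.update x m y i ∈ S t)
            = (Finset.range m).filter (fun i => x i ∈ S t) := by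
          refine Finset.filter_congr fun i hi => ?_
          rw [Function.update_of_ne (Finset.mem_range.1 hi).ne]
        rw [Finset.range_add_one, Finset.filter_insert, h1]
        by_cases h : y ∈ S t
        · simp [h, hw, pow_succ]
        · simp [h, hw]
      simp only [key]
      calc f y ≤ (∑ t ∈ T, w t) * (1 + 2 * A * q) := hfy
        _ ≤ (T.card * (1 + 2 * A * q) ^ m) * (1 + 2 * A * q) := by gcongr
        _ = _ := by ring

/-! ### Volume of caps and nets of the sphere -/

open MeasureTheory in
/-- The part of the unit ball in the cone around `u` of half-angle `arccos s` has relative volume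
at most `√(1 - s²) ^ n`. -/
theorem volume_cone_inter_closedBall_le {n : ℕ} {u : EuclideanSpace ℝ (Fin n)} (hu : ‖u‖ = 1)
    {s : ℝ} (hs : 0 ≤ s) (hs1 : 2 * s ^ 2 ≤ 1) :
    volume ({x : EuclideanSpace ℝ (Fin n) | s * ‖x‖ ≤ inner ℝ u x} ∩ closedBall 0 1)
      ≤ ENNReal.ofReal (√(1 - s ^ 2) ^ n) *
        volume (closedBall (0 : EuclideanSpace ℝ (Fin n)) 1) := by
  -- With `r = ‖x‖`, the squared distance to `s • u` is at most `r² - 2s²r + s²`. This is convex in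
  -- `r`, with values `s²` and `1 - s²` at 0 and 1, and `s² ≤ 1 - s²`.
  have hsub : ({x : EuclideanSpace ℝ (Fin n) | s * ‖x‖ ≤ inner ℝ u x} ∩ closedBall 0 1)
      ⊆ closedBall (s • u) (√(1 - s ^ 2)) := by
    rintro x ⟨hx, hx1⟩
    simp only [Set.mem_ofPred_eq, mem_closedBall, dist_zero_right] at hx hx1 ⊢
    rw [dist_eq_norm]
    refine Real.le_sqrt_of_sq_le ?_
    rw [norm_sub_sq_real, norm_smul, hu, inner_smul_right, real_inner_comm, Real.norm_eq_abs,
      mul_one, sq_abs]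
    nlinarith [norm_nonneg x, mul_le_mul_of_nonneg_left hx hs,
      mul_nonneg (sub_nonneg.2 hx1) (norm_nonneg x), mul_nonneg (sub_nonneg.2 hx1) (sub_nonneg.2 hs1)]
  refine (measure_mono hsub).trans ?_
  rw [Measure.addHaar_closedBall' _ _ (Real.sqrt_nonneg _), finrank_euclideanSpace_fin]

open MeasureTheory in
/-- Separated subsets of the unit ball have at most `(1 + 2 / ε) ^ n` points. -/
theorem card_le_of_separated_of_norm_le {n : ℕ} {ε : ℝ} (hε : 0 < ε)
    (s : Finset (EuclideanSpace ℝ (Fin n))) (hs : ∀ c ∈ s, ‖c‖ ≤ 1)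
    (h : ∀ c ∈ s, ∀ d ∈ s, c ≠ d → ε ≤ ‖c - d‖) : (s.card : ℝ) ≤ (1 + 2 / ε) ^ n := by
  set μ : Measure (EuclideanSpace ℝ (Fin n)) := volume
  have D : Set.Pairwise (s : Set (EuclideanSpace ℝ (Fin n)))
      (Function.onFun Disjoint fun c => ball c (ε / 2)) := by
    rintro c hc d hd hcd
    apply ball_disjoint_ball
    rw [dist_eq_norm]
    linarith [h c hc d hd hcd]
  have hsub : (⋃ c ∈ s, ball c (ε / 2)) ⊆ ball (0 : EuclideanSpace ℝ (Fin n)) (1 + ε / 2) := by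
    refine Set.iUnion₂_subset fun x hx => ball_subset_ball' ?_
    rw [dist_zero_right]
    linarith [hs x hx]
  have I := measure_mono (μ := μ) hsub
  rw [measure_biUnion_finset D fun c _ => measurableSet_ball] at I
  simp only [Measure.addHaar_ball_of_pos μ _ (half_pos hε),
    Measure.addHaar_ball_of_pos μ _ (show 0 < 1 + ε / 2 by positivity),
    Finset.sum_const, nsmul_eq_mul, finrank_euclideanSpace_fin] at I
  rw [← mul_assoc, ENNReal.mul_le_mul_iff_left (measure_ball_pos μ _ one_pos).ne'
    measure_ball_lt_top.ne] at I
  rw [← ENNReal.ofReal_natCast, ← ENNReal.ofReal_mul (by positivity),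
    ENNReal.ofReal_le_ofReal_iff (by positivity)] at I
  have e : 1 + 2 / ε = (1 + ε / 2) / (ε / 2) := by field_simp; ring
  rw [e, div_pow, le_div_iff₀ (by positivity)]
  exact I

/-- A net of the unit sphere of exponential size. -/
theorem exists_net_sphere (n : ℕ) {ε : ℝ} (hε : 0 < ε) :
    ∃ T : Finset (EuclideanSpace ℝ (Fin n)), (T.card : ℝ) ≤ (1 + 2 / ε) ^ n ∧
      (∀ t ∈ T, ‖t‖ = 1) ∧ ∀ p, ‖p‖ = 1 → ∃ t ∈ T, ‖p - t‖ ≤ ε := by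
  classical
  let P : ℕ → Prop := fun k => ∃ T : Finset (EuclideanSpace ℝ (Fin n)), T.card = k ∧
    (∀ t ∈ T, ‖t‖ = 1) ∧ ∀ c ∈ T, ∀ d ∈ T, c ≠ d → ε ≤ ‖c - d‖
  have hbd : ∀ k, P k → k ≤ ⌈(1 + 2 / ε) ^ n⌉₊ := by
    rintro k ⟨T, rfl, h1, h2⟩
    have := (card_le_of_separated_of_norm_le hε T (fun c hc => (h1 c hc).le) h2).trans
      (Nat.le_ceil _)
    exact_mod_cast this
  have h0 : P 0 := ⟨∅, by simp⟩
  -- A separated set of maximal size is a net: an uncovered point could be added to it.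
  obtain ⟨T, hTc, hT1, hTs⟩ : P (Nat.findGreatest P ⌈(1 + 2 / ε) ^ n⌉₊) :=
    Nat.findGreatest_spec (Nat.zero_le _) h0
  refine ⟨T, card_le_of_separated_of_norm_le hε T (fun c hc => (hT1 c hc).le) hTs, hT1, ?_⟩
  intro p hp
  by_contra! hcon
  have hpT : p ∉ T := fun h => by
    have := hcon p h
    simp at this
    linarith
  have hP : P (T.card + 1) := by
    refine ⟨insert p T, Finset.card_insert_of_notMem hpT, ?_, ?_⟩
    · intro t ht
      rcases Finset.mem_insert.1 ht with rfl | ht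
      · exact hp
      · exact hT1 t ht
    · intro c hc d hd hcd
      rcases Finset.mem_insert.1 hc with rfl | hc' <;> rcases Finset.mem_insert.1 hd with rfl | hd'
      · exact absurd rfl hcd
      · exact (hcon d hd').le
      · rw [norm_sub_rev]; exact (hcon c hc').le
      · exact hTs c hc' d hd' hcd
  have := Nat.le_findGreatest (hbd _ hP) hP
  omega

/-! ### The spherical code -/

open MeasureTheory in
/-- For every `b < 2 / √3` there are, in high dimensions, `b ^ n` unit vectors at mutual angles
less than `120°` such that every cap of angular radius `60°` contains boundedly many of them. -/
theorem exists_spherical_code {b : ℝ} (hb1 : 1 < b) (hb : b < 2 / √3) :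
    ∃ k : ℕ, 0 < k ∧ ∀ᶠ n : ℕ in atTop, ∃ (N : ℕ) (y : Fin N → EuclideanSpace ℝ (Fin n)),
      b ^ n ≤ N ∧ (∀ i, ‖y i‖ = 1) ∧ (∀ i j, i ≠ j → -(1 / 2) < inner ℝ (y i) (y j)) ∧
      ∀ p, ‖p‖ = 1 → (Finset.univ.filter fun i => 1 / 2 ≤ inner ℝ p (y i)).card ≤ k := by
  classical
  have hb0 : 0 < b := by linarith
  -- The slack `1/2 - s` is the mesh of the net: a 60° cap about `p` lies in the cap of cosine `s`
  -- about a net point near `p`.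
  obtain ⟨s, hs0, hs2, hbs⟩ : ∃ s : ℝ, 0 < s ∧ s < 1 / 2 ∧ b * √(1 - s ^ 2) < 1 := by
    have hc : ContinuousAt (fun s : ℝ => b * √(1 - s ^ 2)) (1 / 2) := by fun_prop
    have hlt : b * √(1 - (1 / 2) ^ 2) < 1 := by
      have h3 : √(1 - (1 / 2 : ℝ) ^ 2) = √3 / 2 := by
        rw [show (1 - (1 / 2 : ℝ) ^ 2) = 3 / 2 ^ 2 by norm_num, Real.sqrt_div (by norm_num),
          Real.sqrt_sq (by norm_num)]
      rw [h3]
      rw [lt_div_iff₀ (by positivity)] at hb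
      linarith
    have h1 : ∀ᶠ s in 𝓝[<] (1 / 2 : ℝ), b * √(1 - s ^ 2) < 1 :=
      (hc.eventually (gt_mem_nhds hlt)).filter_mono nhdsWithin_le_nhds
    have h2 : ∀ᶠ s in 𝓝[<] (1 / 2 : ℝ), s ∈ Set.Ioo (0 : ℝ) (1 / 2) :=
      Ioo_mem_nhdsLT (by norm_num)
    obtain ⟨s, h1, h2⟩ := (h1.and h2).exists
    exact ⟨s, h2.1, h2.2, h1⟩
  set q := √(1 - s ^ 2) with hq
  have hq0 : 0 < q := Real.sqrt_pos.2 (by nlinarith)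
  set K : ℝ := 1 + 2 / (1 / 2 - s) with hK
  have hε : 0 < 1 / 2 - s := by linarith
  have hK1 : 1 ≤ K := by rw [hK]; have := div_pos two_pos hε; linarith
  -- With weight `A = a ^ n` and about `b ^ n` points of cap measure `q ^ n`, the product `A * q ^ n
  -- * b ^ n` is exactly 1, so the moment per cap stays below `exp 8`, while `a > 1` still punishes
  -- each point in a cap exponentially.
  set a := 1 / (b * q) with ha
  have hbq : 0 < b * q := by positivity
  have ha1 : 1 < a := by rw [ha, lt_div_iff₀ hbq]; linarith
  obtain ⟨k, hk⟩ := pow_unbounded_of_one_lt (K * Real.exp 8) ha1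
  refine ⟨k + 1, k.succ_pos, ?_⟩
  have hsmall : ∀ᶠ n : ℕ in atTop, (b * q) ^ n < 1 / 8 :=
    (tendsto_pow_atTop_nhds_zero_of_lt_one hbq.le hbs).eventually (gt_mem_nhds (by norm_num))
  filter_upwards [hsmall, eventually_ge_atTop 1] with n hn hn1
  set N := ⌈b ^ n⌉₊ with hN
  have hbn : 1 ≤ b ^ n := one_le_pow₀ hb1.le
  have hN1 : b ^ n ≤ N := Nat.le_ceil _
  have hN2 : (N : ℝ) + 1 ≤ 4 * b ^ n := by
    have := (Nat.ceil_lt_add_one (show 0 ≤ b ^ n by positivity)).le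
    linarith
  obtain ⟨T, hTc, hT1, hTn⟩ := exists_net_sphere n hε
  let E := EuclideanSpace ℝ (Fin n)
  let B : Set E := closedBall 0 1
  let μ : Measure E := ProbabilityTheory.cond volume B
  have hB0 : volume B ≠ 0 := (measure_closedBall_pos _ _ one_pos).ne'
  have hBt : volume B ≠ ∞ := measure_closedBall_lt_top.ne
  have : IsProbabilityMeasure μ := ProbabilityTheory.cond_isProbabilityMeasure_of_finite hB0 hBt
  let C : ℝ → E → Set E := fun r u => {x | r * ‖x‖ ≤ inner ℝ u x}
  have hCm : ∀ r u, MeasurableSet (C r u) := fun r u =>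
    (isClosed_le (by fun_prop) (by fun_prop)).measurableSet
  have hcap : ∀ u : E, ‖u‖ = 1 → ∀ r, s ≤ r → r ≤ 1 / 2 → μ.real (C r u) ≤ q ^ n := by
    intro u hu r hr hr2
    have hv := volume_cone_inter_closedBall_le hu (s := r) (by linarith) (by nlinarith)
    have h1 : μ (C r u) ≤ ENNReal.ofReal (√(1 - r ^ 2) ^ n) := by
      rw [ProbabilityTheory.cond_apply measurableSet_closedBall, Set.inter_comm]
      calc _ ≤ (volume B)⁻¹ * (ENNReal.ofReal (√(1 - r ^ 2) ^ n) * volume B) := by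
            gcongr
        _ = _ := by rw [mul_left_comm, ENNReal.inv_mul_cancel hB0 hBt, mul_one]
    calc μ.real (C r u) ≤ √(1 - r ^ 2) ^ n :=
          ENNReal.toReal_le_of_le_ofReal (by positivity) h1
      _ ≤ q ^ n := by
          have : √(1 - r ^ 2) ≤ q := Real.sqrt_le_sqrt (by nlinarith)
          gcongr
  -- In positive dimension the origin, which cannot be normalized, is a null set.
  have : Nonempty (Fin n) := ⟨⟨0, hn1⟩⟩
  have hZ : μ.real ({0} : Set E) = 0 := by
    rw [measureReal_def, ProbabilityTheory.cond_apply measurableSet_closedBall,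
      measure_mono_null Set.inter_subset_right (measure_singleton _)]
    simp
  have hnorm : ∀ x : E, x ∉ ({0} : Set E) → ‖‖x‖⁻¹ • x‖ = 1 := fun x hx => by
    rw [norm_smul, norm_inv, norm_norm, inv_mul_cancel₀ (norm_ne_zero_iff.2 hx)]
  obtain ⟨x, hxZ, hxB, hxS⟩ := exists_greedy_selection μ T (C s)
    (fun x => C (1 / 2) (-(‖x‖⁻¹ • x))) {0} (hCm s) (fun x => hCm _ _) (measurableSet_singleton 0)
    hZ (q := q ^ n) (A := a ^ n) (by positivity) (fun t ht => hcap t (hT1 t ht) s le_rfl hs2.le)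
    (fun x hx => hcap _ (by rw [norm_neg]; exact hnorm x hx) _ hs2.le le_rfl) N
    (by
      calc (N : ℝ) * q ^ n ≤ 4 * b ^ n * q ^ n := by gcongr; linarith
        _ = 4 * (b * q) ^ n := by rw [mul_pow]; ring
        _ ≤ 1 / 2 := by linarith) (by positivity)
  have hx0 : ∀ i : Fin N, ‖x i‖ ≠ 0 := fun i => norm_ne_zero_iff.2 (hxZ i i.2)
  have hlt : ∀ i j : Fin N, i < j → -(1 / 2) < inner ℝ (‖x i‖⁻¹ • x i) (‖x j‖⁻¹ • x j) := by
    intro i j hij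
    have h := hxB i j hij j.2
    simp only [C, Set.mem_ofPred_eq, not_le, inner_neg_left] at h
    rw [inner_smul_right, ← div_eq_inv_mul, lt_div_iff₀ ((norm_nonneg _).lt_of_ne' (hx0 j))]
    linarith
  refine ⟨N, fun i => ‖x i‖⁻¹ • x i, hN1, fun i => hnorm _ (hxZ i i.2), ?_, ?_⟩
  · intro i j hij
    rcases lt_or_gt_of_ne hij with h | h
    · exact hlt i j h
    · rw [real_inner_comm]; exact hlt j i h
  · intro p hp
    obtain ⟨t, htT, ht⟩ := hTn p hp
    set c := ((Finset.range N).filter (fun i => x i ∈ C s t)).card with hc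
    have h1 : (Finset.univ.filter fun i : Fin N => 1 / 2 ≤ inner ℝ p (‖x i‖⁻¹ • x i)).card ≤ c := by
      refine Finset.card_le_card_of_injOn (fun i => (i : ℕ)) ?_ Fin.val_injective.injOn
      intro i hi
      simp only [Finset.coe_filter, Finset.mem_univ, true_and, Set.mem_ofPred_eq] at hi
      simp only [Finset.coe_filter, Finset.mem_range, Set.mem_ofPred_eq, C]
      refine ⟨i.2, ?_⟩
      have h2 : inner ℝ (p - t) (‖x i‖⁻¹ • x i) ≤ 1 / 2 - s := by
        refine (real_inner_le_norm _ _).trans ?_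
        rw [hnorm _ (hxZ i i.2), mul_one]
        exact ht
      have h3 : s ≤ inner ℝ t (‖x i‖⁻¹ • x i) := by
        rw [inner_sub_left] at h2
        linarith
      rwa [inner_smul_right, ← div_eq_inv_mul,
        le_div_iff₀ ((norm_nonneg _).lt_of_ne' (hx0 i))] at h3
    refine h1.trans ((?_ : c ≤ k).trans k.le_succ)
    -- A cap with more than `k` points would by itself contribute more than `(a ^ k) ^ n > (K * exp
    -- 8) ^ n` to the moment sum.
    by_contra! hck
    have h4 : (1 + a ^ n) ^ c ≤ T.card * (1 + 2 * a ^ n * q ^ n) ^ N :=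
      (Finset.single_le_sum (f := fun t => (1 + a ^ n) ^
        ((Finset.range N).filter (fun i => x i ∈ C s t)).card) (fun _ _ => by positivity) htT).trans
        hxS
    have h5 : (1 + 2 * a ^ n * q ^ n) ^ N ≤ Real.exp 8 := by
      have e : a ^ n * q ^ n * b ^ n = 1 := by
        rw [← mul_pow, ← mul_pow, ha]
        field_simp
        simp
      calc (1 + 2 * a ^ n * q ^ n) ^ N ≤ Real.exp (2 * a ^ n * q ^ n) ^ N := by
            gcongr; linarith [Real.add_one_le_exp (2 * a ^ n * q ^ n)]
        _ = Real.exp (N * (2 * a ^ n * q ^ n)) := (Real.exp_nat_mul _ _).symm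
        _ ≤ Real.exp 8 := by
            gcongr
            have h6 : (N : ℝ) * (2 * (a ^ n * q ^ n)) ≤ 4 * b ^ n * (2 * (a ^ n * q ^ n)) := by
              gcongr; linarith
            linarith
    have h7 : (a ^ k) ^ n ≤ (K * Real.exp 8) ^ n := by
      calc (a ^ k) ^ n = (a ^ n) ^ k := by rw [← pow_mul, ← pow_mul, mul_comm]
        _ ≤ (1 + a ^ n) ^ k := by gcongr; linarith
        _ ≤ (1 + a ^ n) ^ c :=
            pow_le_pow_right₀ (by linarith [show 0 < a ^ n by positivity]) hck.le
        _ ≤ K ^ n * Real.exp 8 := h4.trans (by gcongr)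
        _ ≤ K ^ n * Real.exp 8 ^ n := by
            gcongr
            exact le_self_pow₀ (Real.one_le_exp (by norm_num)) (by omega)
        _ = _ := (mul_pow _ _ _).symm
    exact absurd (lt_of_pow_lt_pow_left₀ n (by positivity) (h7.trans_lt
      (pow_lt_pow_left₀ hk (by positivity) (by omega)))) (lt_irrefl _)

/-! ### Counting, and the Gallai number -/

theorem card_le_mul_card_of_fibers {α : Type*} {N k : ℕ} (P : Finset α) (R : α → Fin N → Prop)
    (hR : ∀ i, ∃ p ∈ P, R p i) (y : α → Finset (Fin N)) (hy : ∀ p i, R p i → i ∈ y p)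
    (hk : ∀ p, (y p).card ≤ k) : N ≤ k * P.card := by
  classical
  have h : (Finset.univ : Finset (Fin N)) ⊆ P.biUnion y := by
    intro i _
    obtain ⟨p, hp, h⟩ := hR i
    exact Finset.mem_biUnion.2 ⟨p, hp, hy p i h⟩
  calc N = (Finset.univ : Finset (Fin N)).card := (Finset.card_fin N).symm
    _ ≤ (P.biUnion y).card := Finset.card_le_card h
    _ ≤ P.card * k := Finset.card_biUnion_le_card_mul _ _ _ fun p _ => hk p
    _ = _ := mul_comm _ _

/-- Normalizing `p` extends the cap bound to piercing points of any norm; `p = 0` must be excluded,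
since it would satisfy the inequality for every index. -/
theorem card_filter_half_norm_le {n N k : ℕ} {y : Fin N → EuclideanSpace ℝ (Fin n)}
    (hk : ∀ p, ‖p‖ = 1 → (Finset.univ.filter fun i => 1 / 2 ≤ inner ℝ p (y i)).card ≤ k)
    (p : EuclideanSpace ℝ (Fin n)) :
    (Finset.univ.filter fun i => p ≠ 0 ∧ ‖p‖ / 2 ≤ inner ℝ p (y i)).card ≤ k := by
  classical
  by_cases hp : p = 0
  · simp [hp]
  · have hp0 : 0 < ‖p‖ := norm_pos_iff.2 hp
    refine (Finset.card_le_card fun i hi => ?_).trans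
      (hk (‖p‖⁻¹ • p) (by rw [norm_smul, norm_inv, norm_norm, inv_mul_cancel₀ hp0.ne']))
    simp only [Finset.mem_filter, Finset.mem_univ, true_and] at hi ⊢
    rw [real_inner_smul_left, ← div_eq_inv_mul, le_div_iff₀ hp0]
    linarith [hi.2]

/-- The balls of radius `√3 / 2` centred at a spherical code need many piercing points. -/
theorem le_gallaiNumber {n N k m : ℕ} {y : Fin N → EuclideanSpace ℝ (Fin n)}
    (hy1 : ∀ i, ‖y i‖ = 1) (hy : ∀ i j, i ≠ j → -(1 / 2) < inner ℝ (y i) (y j))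
    (hk : ∀ p, ‖p‖ = 1 → (Finset.univ.filter fun i => 1 / 2 ≤ inner ℝ p (y i)).card ≤ k)
    (hm : ∀ l : ℕ, N ≤ k * l → m ≤ l) : (m : ℕ∞) ≤ gallaiNumber n := by
  have h3 : √3 ^ 2 = (3 : ℝ) := Real.sq_sqrt (by norm_num)
  have h30 : 0 < √(3 : ℝ) := by positivity
  refine le_iInf₂ fun l hl => ?_
  norm_cast
  refine hm l ?_
  have hF : IsGallaiFamily (Set.range fun i => closedBall (y i) (√3 / 2)) := by
    refine ⟨Set.finite_range _, ?_, ?_⟩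
    · rintro _ ⟨i, rfl⟩
      exact ⟨y i, √3 / 2, by positivity, rfl⟩
    · rintro _ ⟨i, rfl⟩ _ ⟨j, rfl⟩
      have hij : -(1 / 2) < inner ℝ (y i) (y j) := by
        by_cases h : i = j
        · rw [h, real_inner_self_eq_norm_sq, hy1]; norm_num
        · exact hy i j h
      have h1 : ‖y i - y j‖ ≤ √3 := by
        refine Real.le_sqrt_of_sq_le ?_
        rw [norm_sub_sq_real, hy1, hy1]
        linarith
      refine ⟨midpoint ℝ (y i) (y j), ?_, ?_⟩
      · rw [mem_closedBall, dist_midpoint_left, dist_eq_norm, Real.norm_eq_abs,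
          abs_of_pos two_pos]
        linarith
      · rw [mem_closedBall, dist_midpoint_right, dist_eq_norm, Real.norm_eq_abs,
          abs_of_pos two_pos]
        linarith
  obtain ⟨P, hPl, hP⟩ := hl (Set.range fun i => closedBall (y i) (√3 / 2)) hF
  refine (card_le_mul_card_of_fibers P (fun p i => p ∈ closedBall (y i) (√3 / 2))
    (fun i => hP _ ⟨i, rfl⟩) _ (fun p i hpi => ?_) (card_filter_half_norm_le hk)).trans
    (Nat.mul_le_mul_left k hPl)
  simp only [Finset.mem_filter, Finset.mem_univ, true_and]
  rw [mem_closedBall, dist_eq_norm] at hpi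
  have h1 : ‖p - y i‖ ^ 2 ≤ 3 / 4 := by nlinarith [norm_nonneg (p - y i)]
  rw [norm_sub_sq_real, hy1] at h1
  -- Here `2⟨p, y i⟩ ≥ ‖p‖² + 1/4 ≥ ‖p‖`; the origin is at distance `1 > √3/2` from every centre.
  refine ⟨?_, by nlinarith [sq_nonneg (‖p‖ - 1 / 2)]⟩
  rintro rfl
  norm_num at h1

/-! ### Geometry of spiky balls -/

section Spike

variable {n : ℕ} {X : Set (EuclideanSpace ℝ (Fin n))} {R : ℝ}

/-- The functional `⟨x, ·⟩` separates: it is at most `R` on the unit ball and `⟨x, z⟩` at `z`, both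
strictly below its value `R²` at `x`. -/
theorem notMem_closure_spike {x z : EuclideanSpace ℝ (Fin n)} (hR : 1 < R) (hx : ‖x‖ = R)
    (hz : ‖z‖ = R) (hxz : x ≠ z) :
    x ∉ closure (convexHull ℝ (closedBall (0 : EuclideanSpace ℝ (Fin n)) 1 ∪ {z})) := by
  intro h
  have hsub : convexHull ℝ (closedBall (0 : EuclideanSpace ℝ (Fin n)) 1 ∪ {z})
      ⊆ {v | inner ℝ x v ≤ max R (inner ℝ x z)} := by
    refine convexHull_min ?_ (convex_halfSpace_le (innerₗ _ x).isLinear _)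
    rintro v (hv | rfl)
    · rw [mem_closedBall, dist_zero_right] at hv
      have := real_inner_le_norm x v
      rw [hx] at this
      exact (this.trans (by nlinarith)).trans (le_max_left _ _)
    · exact le_max_right R (inner ℝ x v)
  have h1 : 0 < ‖x - z‖ ^ 2 := by
    have := norm_pos_iff.2 (sub_ne_zero.2 hxz)
    positivity
  rw [norm_sub_sq_real, hx, hz] at h1
  have h2 := closure_minimal hsub (isClosed_le (by fun_prop) continuous_const) h
  rw [Set.mem_ofPred_eq, real_inner_self_eq_norm_sq, hx] at h2
  rcases le_max_iff.1 h2 with h2 | h2 <;> nlinarith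

theorem mem_spikyBall {x : EuclideanSpace ℝ (Fin n)} (hx : x ∈ X) : x ∈ spikyBall X :=
  Set.mem_biUnion hx (subset_convexHull ℝ _ (Or.inr rfl))

theorem spikyBall_subset_closedBall (hR : 1 < R) (hX : ∀ x ∈ X, ‖x‖ = R) :
    spikyBall X ⊆ closedBall 0 R := by
  refine Set.iUnion₂_subset fun x hx => convexHull_min ?_ (convex_closedBall _ _)
  refine Set.union_subset (closedBall_subset_closedBall hR.le) ?_
  simp [hX x hx]

theorem mem_frontier_spikyBall (hR : 1 < R) (hX : ∀ x ∈ X, ‖x‖ = R)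
    {x : EuclideanSpace ℝ (Fin n)} (hx : x ∈ X) : x ∈ frontier (spikyBall X) := by
  refine ⟨subset_closure (mem_spikyBall hx), fun h => ?_⟩
  have := interior_mono (spikyBall_subset_closedBall hR hX) h
  rw [interior_closedBall _ (by linarith), mem_ball, dist_zero_right, hX x hx] at this
  exact lt_irrefl _ this

theorem isSpikyBallWithVertices_spikyBall (hR : 1 < R) (hX : ∀ x ∈ X, ‖x‖ = R) (hf : X.Finite)
    (hne : X.Nonempty) : IsSpikyBallWithVertices (spikyBall X) X := by
  refine ⟨hf, hne, fun x hx => (hX x hx).symm ▸ hR, rfl, fun x hx h => ?_⟩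
  have hmem := mem_spikyBall hx
  rw [← h] at hmem
  obtain ⟨z, hz, hxz⟩ := Set.mem_iUnion₂.1 hmem
  exact notMem_closure_spike hR (hX x hx) (hX z hz.1) (fun e => hz.2 e.symm)
    (subset_closure hxz)

/-- A direction entering the interior of the unit ball illuminates the vertex. -/
theorem illuminates_of_norm_lt_one {x u : EuclideanSpace ℝ (Fin n)} (hx : x ∈ X) {τ : ℝ}
    (hτ : 0 < τ) (h : ‖x + τ • u‖ < 1) : Illuminates (spikyBall X) u x := by
  intro ε hε
  set K := convexHull ℝ (closedBall (0 : EuclideanSpace ℝ (Fin n)) 1 ∪ {x})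
  have hKX : K ⊆ spikyBall X := Set.subset_biUnion_of_mem (u := fun x =>
    convexHull ℝ (closedBall (0 : EuclideanSpace ℝ (Fin n)) 1 ∪ {x})) hx
  have hint : x + τ • u ∈ interior K := by
    refine mem_interior.2 ⟨ball 0 1, ?_, isOpen_ball, by simpa using h⟩
    exact (ball_subset_closedBall.trans Set.subset_union_left).trans (subset_convexHull ℝ _)
  have hxK : x ∈ K := subset_convexHull ℝ _ (Or.inr rfl)
  obtain ⟨θ, hθ0, hθ⟩ : ∃ θ : ℝ, 0 < θ ∧ θ < 1 ∧ θ * τ < ε := by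
    refine ⟨min (1 / 2) (ε / (2 * τ)), by positivity, (min_le_left _ _).trans_lt (by norm_num), ?_⟩
    calc min (1 / 2) (ε / (2 * τ)) * τ ≤ ε / (2 * τ) * τ := by gcongr; exact min_le_right _ _
      _ = ε / 2 := by field_simp
      _ < ε := by linarith
  refine ⟨θ * τ, by positivity, hθ.2, interior_mono hKX ?_⟩
  have := (convex_convexHull ℝ _).combo_interior_self_mem_interior hint hxK hθ0
    (sub_nonneg.2 hθ.1.le) (by ring)
  convert this using 1
  module

/-- A direction illuminating a vertex of norm `2 / √3` is within `60°` of the opposite of the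
vertex. -/
theorem half_le_inner_of_illuminates (hf : X.Finite) (hX : ∀ x ∈ X, ‖x‖ = 2 / √3)
    {u y : EuclideanSpace ℝ (Fin n)} (hu : ‖u‖ = 1) (hy : ‖y‖ = 1) (hyX : (2 / √3) • y ∈ X)
    (h : Illuminates (spikyBall X) u ((2 / √3) • y)) : 1 / 2 ≤ inner ℝ (-u) y := by
  set R : ℝ := 2 / √3 with hR
  have h30 : 0 < √(3 : ℝ) := by positivity
  have h3 : √3 ^ 2 = (3 : ℝ) := Real.sq_sqrt (by norm_num)
  have hR2 : R ^ 2 = 4 / 3 := by rw [hR, div_pow, h3]; norm_num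
  have hR0 : 0 < R := by positivity
  have hR1 : 1 < R := by nlinarith
  set x := R • y with hx
  -- The other spikes form a closed set missing `x`, so near `x` only its own spike counts.
  set C : Set (EuclideanSpace ℝ (Fin n)) := ⋃ z ∈ X \ {x},
    closure (convexHull ℝ (closedBall (0 : EuclideanSpace ℝ (Fin n)) 1 ∪ {z})) with hC
  have hCc : IsClosed C :=
    (hf.subset Set.sdiff_subset).isClosed_biUnion fun z _ => isClosed_closure
  have hxC : x ∉ C := by
    intro hxC
    obtain ⟨z, hz, hxz⟩ := Set.mem_iUnion₂.1 hxC
    exact notMem_closure_spike hR1 (hX x hyX) (hX z hz.1) (fun e => hz.2 e.symm) hxz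
  obtain ⟨ε, hε, hball⟩ := Metric.isOpen_iff.1 hCc.isOpen_compl x hxC
  obtain ⟨t, ht0, htε, ht⟩ := h ε hε
  have htC : x + t • u ∉ C := hball (by
    rw [mem_ball, dist_self_add_left, norm_smul, hu, mul_one, Real.norm_of_nonneg ht0.le]
    exact htε)
  have htx : x + t • u ∈ convexHull ℝ (closedBall (0 : EuclideanSpace ℝ (Fin n)) 1 ∪ {x}) := by
    obtain ⟨z, hz, hmem⟩ := Set.mem_iUnion₂.1 (interior_subset ht)
    by_cases hzx : z = x
    · rwa [hzx] at hmem
    · exact absurd (Set.mem_biUnion (show z ∈ X \ {x} from ⟨hz, hzx⟩)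
        (subset_closure hmem)) htC
  rw [Set.union_singleton, convexHull_insert (nonempty_closedBall.2 zero_le_one),
    (convex_closedBall _ _).convexHull_eq] at htx
  obtain ⟨_, rfl, v, hv, hseg⟩ := mem_convexJoin.1 htx
  obtain ⟨α, β, hα, hβ, hαβ, hxv⟩ := hseg
  have hut : t • u = β • (v - x) := by
    have hα' : α = 1 - β := by linarith
    have : t • u = (α • x + β • v) - x := by rw [hxv]; abel
    rw [this, hα']; module
  rw [mem_closedBall, dist_zero_right] at hv
  have hnorm : t = β * ‖v - x‖ := by
    have := congrArg norm hut
    rwa [norm_smul, norm_smul, hu, mul_one, Real.norm_of_nonneg ht0.le,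
      Real.norm_of_nonneg hβ] at this
  have hinner : t * inner ℝ u y = β * inner ℝ (v - x) y := by
    rw [← real_inner_smul_left, hut, real_inner_smul_left]
  set γ := inner ℝ v y with hγ
  have hvx : inner ℝ (v - x) y = γ - R := by
    rw [inner_sub_left, hx, real_inner_smul_left, real_inner_self_eq_norm_sq, hy]; ring
  have hγ1 : γ ≤ 1 := by
    have := real_inner_le_norm v y
    rw [hy, mul_one] at this
    exact this.trans hv
  -- The spike's half-angle is 60°: the right side exceeds `1 - 2Rγ + R²` by `4(γ - √3/2)²`, which
  -- vanishes at the tangency height.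
  have hn2 : ‖v - x‖ ^ 2 ≤ (2 * (R - γ)) ^ 2 := by
    rw [norm_sub_sq_real, hx, real_inner_smul_right, norm_smul, hy, Real.norm_of_nonneg hR0.le,
      mul_one, hR2, ← hγ]
    have h4 : √3 * R = 2 := by rw [hR]; field_simp
    nlinarith [sq_nonneg (γ - √3 / 2), norm_nonneg v, sq_nonneg (√3 * R - 2)]
  have hn : ‖v - x‖ ≤ 2 * (R - γ) := le_of_pow_le_pow_left₀ two_ne_zero (by linarith) hn2
  rw [inner_neg_left]
  rw [hvx] at hinner
  have : t * (1 / 2) ≤ t * -inner ℝ u y := by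
    rw [mul_neg, hinner, hnorm]
    nlinarith
  exact le_of_mul_le_mul_left this ht0

end Spike

/-- The spiky ball over a spherical code needs many illuminating directions. -/
theorem le_maxSpikyIllumination {n N k m : ℕ} {y : Fin N → EuclideanSpace ℝ (Fin n)} (hN : 0 < N)
    (hy1 : ∀ i, ‖y i‖ = 1) (hy : ∀ i j, i ≠ j → -(1 / 2) < inner ℝ (y i) (y j))
    (hk : ∀ p, ‖p‖ = 1 → (Finset.univ.filter fun i => 1 / 2 ≤ inner ℝ p (y i)).card ≤ k)
    (hm : ∀ l : ℕ, N ≤ k * l → m ≤ l) : (m : ℕ∞) ≤ maxSpikyIllumination n := by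
  have h30 : 0 < √(3 : ℝ) := by positivity
  have h3 : √3 ^ 2 = (3 : ℝ) := Real.sq_sqrt (by norm_num)
  set R : ℝ := 2 / √3 with hR
  have hR2 : R ^ 2 = 4 / 3 := by rw [hR, div_pow, h3]; norm_num
  have hR0 : 0 < R := by positivity
  have hR1 : 1 < R := by nlinarith
  set X : Set (EuclideanSpace ℝ (Fin n)) := Set.range fun i => R • y i with hXdef
  have hX : ∀ x ∈ X, ‖x‖ = R := by
    rintro _ ⟨i, rfl⟩
    simp only [norm_smul, hy1, Real.norm_of_nonneg hR0.le, mul_one]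
  have hf : X.Finite := Set.finite_range _
  have htwo : IsTwoIlluminableSpikyBall (spikyBall X) := by
    refine ⟨X, isSpikyBallWithVertices_spikyBall hR1 hX hf ⟨_, ⟨⟨0, hN⟩, rfl⟩⟩, ?_⟩
    rintro _ ⟨i, rfl⟩ _ ⟨j, rfl⟩ hij
    have hlt := hy i j (fun e => hij (by rw [e]))
    set c := inner ℝ (y i) (y j) with hc
    set w := y i + y j with hw
    have hw2 : ‖w‖ ^ 2 = 2 + 2 * c := by rw [hw, norm_add_sq_real, hy1, hy1]; ring
    have hw0 : 0 < ‖w‖ := by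
      by_contra h
      have : ‖w‖ = 0 := le_antisymm (not_lt.1 h) (norm_nonneg _)
      rw [this] at hw2
      linarith
    have hcase : ∀ z, ‖z‖ = 1 → inner ℝ z w = 1 + c → R • z ∈ X →
        Illuminates (spikyBall X) (-(‖w‖⁻¹ • w)) (R • z) := by
      intro z hz hzw hzX
      refine illuminates_of_norm_lt_one (τ := R * ‖w‖ / 2) hzX (by positivity) ?_
      -- For `z = y i` the ray reaches `(R/2)(y i - y j)`, of squared norm `(2/3)(1 - c)`, below 1
      -- exactly when `c > -1/2`.
      have e : R • z + (R * ‖w‖ / 2) • -(‖w‖⁻¹ • w) = R • (z - (1 / 2 : ℝ) • w) := by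
        rw [smul_neg, smul_smul, smul_sub, smul_smul]
        rw [show R * ‖w‖ / 2 * ‖w‖⁻¹ = R * (1 / 2) by field_simp]
        abel
      rw [e]
      have h1 : ‖R • (z - (1 / 2 : ℝ) • w)‖ ^ 2 < 1 := by
        rw [norm_smul, mul_pow, norm_sub_sq_real, real_inner_smul_right, norm_smul, hz, hzw,
          mul_pow, hw2, Real.norm_of_nonneg hR0.le, hR2]
        norm_num
        linarith
      exact (sq_lt_one_iff₀ (norm_nonneg _)).1 h1
    refine ⟨-(‖w‖⁻¹ • w), ?_, hcase _ (hy1 i) ?_ ⟨i, rfl⟩, hcase _ (hy1 j) ?_ ⟨j, rfl⟩⟩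
    · rw [norm_neg, norm_smul, norm_inv, norm_norm, inv_mul_cancel₀ hw0.ne']
    · rw [hw, inner_add_right, real_inner_self_eq_norm_sq, hy1]; ring
    · rw [hw, inner_add_right, real_inner_self_eq_norm_sq, hy1, real_inner_comm]; ring
  refine le_trans ?_ (le_iSup₂ (f := fun K (_ : IsTwoIlluminableSpikyBall K) =>
    illuminationNumber K) (spikyBall X) htwo)
  refine le_iInf₂ fun U hU => ?_
  norm_cast
  refine hm _ (card_le_mul_card_of_fibers U (fun u i => ‖u‖ = 1 ∧ 1 / 2 ≤ inner ℝ (-u) (y i))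
    (fun i => ?_) _ (fun u i hui => ?_) (fun u => card_filter_half_norm_le hk (-u)))
  · obtain ⟨u, huU, hu⟩ := hU.2 _ (mem_frontier_spikyBall hR1 hX ⟨i, rfl⟩)
    exact ⟨u, huU, hU.1 u huU, half_le_inner_of_illuminates hf hX (hU.1 u huU) (hy1 i) ⟨i, rfl⟩ hu⟩
  · simp only [Finset.mem_filter, Finset.mem_univ, true_and]
    refine ⟨fun h => ?_, by rw [norm_neg, hui.1]; exact hui.2⟩
    have := hui.1
    rw [neg_eq_zero.1 h] at this
    simp at this

/-! ### Asymptotics and conclusion -/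

/-- If `f n` is at least `b ^ n` up to a constant factor for all `b < c`, then
`f n ≥ (c - o(1)) ^ n`. -/
theorem exists_tendsto_zero_of_forall_pow_le {c : ℝ} (hc : 1 < c) (f : ℕ → ℝ≥0∞)
    (hf : ∀ b, 1 < b → b < c →
      ∃ k : ℕ, 0 < k ∧ ∀ᶠ n : ℕ in atTop, ENNReal.ofReal (b ^ n / k) ≤ f n) :
    ∃ e : ℕ → ℝ, Tendsto e atTop (𝓝 0) ∧
      ∀ᶠ n : ℕ in atTop, ENNReal.ofReal ((c - e n) ^ n) ≤ f n := by
  have hc0 : 0 < c := by linarith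
  -- Truncating at `c ^ n` makes the value finite and its `n`-th root at most `c`; the error is `c`
  -- minus that root.
  set h : ℕ → ℝ := fun n => (min (f n) (ENNReal.ofReal (c ^ n))).toReal with hh
  set g : ℕ → ℝ := fun n => h n ^ (1 / (n : ℝ)) with hg
  have hh0 : ∀ n, 0 ≤ h n := fun n => ENNReal.toReal_nonneg
  have hgp : ∀ n, n ≠ 0 → g n ^ n = h n := fun n hn => by
    rw [hg]
    simp only [one_div]
    exact Real.rpow_inv_natCast_pow (hh0 n) hn
  have hg0 : ∀ n, 0 ≤ g n := fun n => Real.rpow_nonneg (hh0 n) _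
  have hfin : ∀ n, min (f n) (ENNReal.ofReal (c ^ n)) ≠ ∞ := fun n =>
    ((min_le_right _ _).trans_lt ENNReal.ofReal_lt_top).ne
  have hgc : ∀ n, n ≠ 0 → g n ≤ c := fun n hn => by
    refine le_of_pow_le_pow_left₀ hn hc0.le ?_
    rw [hgp n hn]
    exact ENNReal.toReal_le_of_le_ofReal (by positivity) (min_le_right _ _)
  have hlow : ∀ d, d < c → ∀ᶠ n in atTop, d ≤ g n := by
    intro d hd
    obtain ⟨d', hd', hd'c⟩ := exists_between (max_lt hd hc)
    obtain ⟨b, hb, hbc⟩ := exists_between hd'c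
    have hd1 : 1 < d' := (le_max_right _ _).trans_lt hd'
    obtain ⟨k, hk, hev⟩ := hf b (hd1.trans hb) hbc
    have hratio : ∀ᶠ n : ℕ in atTop, (k : ℝ) ≤ (b / d') ^ n :=
      (tendsto_pow_atTop_atTop_of_one_lt
        ((one_lt_div (by linarith)).2 hb)).eventually_ge_atTop _
    filter_upwards [hev, hratio, eventually_ne_atTop 0] with n hn hr hn0
    refine (le_max_left d 1).trans (hd'.le.trans (le_of_pow_le_pow_left₀ hn0 (hg0 n) ?_))
    rw [hgp n hn0]
    have hd'0 : 0 < d' := by linarith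
    have hkpos : (0 : ℝ) < k := by exact_mod_cast hk
    have h1 : d' ^ n ≤ b ^ n / k := by
      rw [div_pow, le_div_iff₀ (by positivity)] at hr
      rw [le_div_iff₀ hkpos]
      linarith
    rw [hh]
    refine (ENNReal.ofReal_le_iff_le_toReal (hfin n)).1 (le_min ?_ ?_)
    · exact (ENNReal.ofReal_le_ofReal h1).trans hn
    · exact ENNReal.ofReal_le_ofReal (by gcongr)
  refine ⟨fun n => c - g n, ?_, ?_⟩
  · have : Tendsto g atTop (𝓝 c) := by
      refine tendsto_order.2 ⟨fun d hd => ?_, fun d hd => ?_⟩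
      · obtain ⟨d', h1, h2⟩ := exists_between hd
        filter_upwards [hlow d' h2] with n hn using h1.trans_le hn
      · filter_upwards [eventually_ne_atTop 0] with n hn using (hgc n hn).trans_lt hd
    simpa using this.const_sub c
  · filter_upwards [eventually_ne_atTop 0] with n hn
    rw [sub_sub_cancel, hgp n hn, hh, ENNReal.ofReal_toReal (hfin n)]
    exact min_le_left _ _

/-- The condition on `m` encodes `m ≤ ⌈N / k⌉` without division; it is applied to `m = ⌈a / k⌉`. -/
theorem ofReal_div_le_toENNReal {a : ℝ} {k N : ℕ} {g : ℕ∞} (hk : 0 < k) (ha : a ≤ N)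
    (h : ∀ m : ℕ, (∀ l : ℕ, N ≤ k * l → m ≤ l) → (m : ℕ∞) ≤ g) :
    ENNReal.ofReal (a / k) ≤ (g : ℝ≥0∞) := by
  have hkpos : (0 : ℝ) < k := by exact_mod_cast hk
  have h1 := h ⌈a / k⌉₊ fun l hl => by
    rw [Nat.ceil_le, div_le_iff₀ hkpos, mul_comm]
    exact ha.trans (by exact_mod_cast hl)
  calc ENNReal.ofReal (a / k) ≤ ((⌈a / k⌉₊ : ℕ) : ℝ≥0∞) := by
        rw [← ENNReal.ofReal_natCast]
        exact ENNReal.ofReal_le_ofReal (Nat.le_ceil _)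
    _ = (((⌈a / k⌉₊ : ℕ) : ℕ∞) : ℝ≥0∞) := by simp
    _ ≤ (g : ℝ≥0∞) := ENat.toENNReal_le.2 h1

theorem mainTheorem6 :
    (∃ e : ℕ → ℝ, Tendsto e atTop (𝓝 0) ∧
      ∀ᶠ n : ℕ in atTop,
        ENNReal.ofReal ((2 / Real.sqrt 3 - e n) ^ n) ≤ ((gallaiNumber n : ℕ∞) : ℝ≥0∞)) ∧
    (∃ e : ℕ → ℝ, Tendsto e atTop (𝓝 0) ∧
      ∀ᶠ n : ℕ in atTop,
        ENNReal.ofReal ((2 / Real.sqrt 3 - e n) ^ n) ≤ ((maxSpikyIllumination n : ℕ∞) : ℝ≥0∞)) := by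
  have hc : 1 < 2 / √3 := by
    rw [one_lt_div (by positivity), Real.sqrt_lt' two_pos]
    norm_num
  constructor
  · refine exists_tendsto_zero_of_forall_pow_le hc _ fun b hb1 hb => ?_
    obtain ⟨k, hk, hev⟩ := exists_spherical_code hb1 hb
    refine ⟨k, hk, hev.mono ?_⟩
    rintro n ⟨N, y, hN, hy1, hy, hyk⟩
    exact ofReal_div_le_toENNReal hk hN fun m hm => le_gallaiNumber hy1 hy hyk hm
  · refine exists_tendsto_zero_of_forall_pow_le hc _ fun b hb1 hb => ?_
    obtain ⟨k, hk, hev⟩ := exists_spherical_code hb1 hb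
    refine ⟨k, hk, hev.mono ?_⟩
    rintro n ⟨N, y, hN, hy1, hy, hyk⟩
    have hN0 : 0 < N := by
      have : (0 : ℝ) < N := lt_of_lt_of_le (by positivity) hN
      exact_mod_cast this
    exact ofReal_div_le_toENNReal hk hN fun m hm => le_maxSpikyIllumination hN0 hy1 hy hyk hm
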